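/- For an integer $n \ge 1$ let $d(n) = \#\{k \ge 1 : k \mid n\}$ denote the number of positive divisors of $n$, and let $\log$ be the natural logarithm. Then the set of values $$\left\{ \frac{d(n)}{2^{\log n/\log\log n}} : n \in \mathbb{N},\ n \ge 3 \right\}$$ is dense in the extended half-line $[0,\infty]$ (with its usual order topology, in which the neighbourhoods of $\infty$ are the sets containing some $(a,\infty]$ with $0 \le a < \infty$). -/

import Mathlib

open Filter Chebyshev

theorem eventually_mul_le_theta : ∀ᶠ x : ℝ in atTop, 0.6 * x ≤ θ x := by
  have h := (isLittleO_log_rpow_atTop (r := 1 / 2) (by norm_num)).bound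
    (c := 0.01) (by norm_num)
  filter_upwards [h, eventually_ge_atTop 100] with x hx hx100
  rw [← Real.sqrt_eq_rpow, Real.norm_of_nonneg (Real.log_nonneg (by linarith)),
    Real.norm_of_nonneg (Real.sqrt_nonneg x)] at hx
  have hθ := theta_ge' (x := x) (by linarith)
  have hs : √x * √x = x := Real.mul_self_sqrt (by linarith)
  have h1 : 1 ≤ √x := Real.one_le_sqrt.2 (by linarith)
  have h2 : Real.log (x + 2) ≤ 2 * Real.log x := by
    rw [← Real.log_rpow (by linarith)]
    refine Real.log_le_log (by linarith) ?_
    norm_num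
    nlinarith
  have h3 : √x * Real.log x ≤ 0.01 * x := by nlinarith
  nlinarith [Real.log_two_gt_d9]

theorem eventually_le_integral_theta :
    ∀ᶠ x : ℝ in atTop,
      0.54 * x / Real.log x ^ 2 ≤ ∫ t in (2 : ℝ)..x, θ t / (t * Real.log t ^ 2) := by
  obtain ⟨T, hT⟩ := eventually_atTop.1 eventually_mul_le_theta
  filter_upwards [eventually_ge_atTop (10 * T), eventually_ge_atTop 100] with x hxT hx
  have hint : IntervalIntegrable (fun t ↦ θ t / (t * Real.log t ^ 2)) MeasureTheory.volume 2 x :=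
    (intervalIntegrable_iff_integrableOn_Icc_of_le (by linarith)).2
      (integrableOn_theta_div_id_mul_log_sq x)
  have hsub : IntervalIntegrable (fun t ↦ θ t / (t * Real.log t ^ 2)) MeasureTheory.volume
      (x / 10) x := hint.mono_set (by
    rw [Set.uIcc_of_le (by linarith), Set.uIcc_of_le (by linarith)]
    exact Set.Icc_subset_Icc_left (by linarith))
  calc
    0.54 * x / Real.log x ^ 2 = ∫ _ in (x / 10)..x, 0.6 / Real.log x ^ 2 := by
      rw [intervalIntegral.integral_const, smul_eq_mul]
      ring
    _ ≤ ∫ t in (x / 10)..x, θ t / (t * Real.log t ^ 2) := by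
      refine intervalIntegral.integral_mono_on (by linarith) intervalIntegrable_const hsub ?_
      intro t ht
      have ht0 : 0 < t := by linarith [ht.1]
      have hlt : 0 < Real.log t := Real.log_pos (by linarith [ht.1])
      calc
        0.6 / Real.log x ^ 2 ≤ 0.6 / Real.log t ^ 2 := by
          gcongr
          exact ht.2
        _ = 0.6 * t / (t * Real.log t ^ 2) := by field_simp
        _ ≤ θ t / (t * Real.log t ^ 2) := by
          gcongr
          exact hT t (by linarith [ht.1])
    _ ≤ _ := by
      refine intervalIntegral.integral_mono_interval (by linarith) (by linarith) le_rfl ?_ hint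
      filter_upwards [MeasureTheory.ae_restrict_mem measurableSet_Ioc] with t ht
      have := theta_nonneg t
      have : 0 < t := by linarith [ht.1]
      simp only [Pi.zero_apply]
      positivity

theorem tendsto_primeCounting_sub_theta_div_log_theta :
    Tendsto (fun x : ℝ ↦ (Nat.primeCounting ⌊x⌋₊ : ℝ) - θ x / Real.log (θ x)) atTop atTop := by
  refine tendsto_atTop.2 fun C ↦ ?_
  have hlog := (Real.isLittleO_pow_log_id_atTop (n := 2)).bound
    (c := 0.04 / (|C| + 1)) (by positivity)
  filter_upwards [hlog, eventually_mul_le_theta, eventually_le_integral_theta,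
    eventually_ge_atTop (Real.exp 4), eventually_ge_atTop 2] with x hx hθ hI hx4 hx2
  have hl : 4 ≤ Real.log x := (Real.le_log_iff_exp_le (by linarith)).2 hx4
  have hu : 0 < θ x := by linarith
  have hm : Real.log x - 1 ≤ Real.log (θ x) := by
    rw [Real.le_log_iff_exp_le hu, Real.exp_sub, Real.exp_log (by linarith),
      div_eq_mul_inv, ← Real.exp_neg]
    nlinarith [Real.exp_neg_one_lt_d9]
  have hul : -(0.37 * x) ≤ θ x * (Real.log (θ x) - Real.log x) := by
    have h := Real.log_le_sub_one_of_pos (x := x * Real.exp (-1) / θ x) (by positivity)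
    rw [Real.log_div (by positivity) hu.ne', Real.log_mul (by linarith) (Real.exp_ne_zero _),
      Real.log_exp] at h
    have h' : Real.log x - Real.log (θ x) ≤ x * Real.exp (-1) / θ x := by linarith
    rw [le_div_iff₀ hu] at h'
    nlinarith [Real.exp_neg_one_lt_d9]
  rw [primeCounting_eq_theta_div_log_add_integral hx2]
  generalize Real.log (θ x) = m at *
  have hC : C ≤ 0.04 * x / Real.log x ^ 2 := by
    rw [Real.norm_of_nonneg (by positivity), id, Real.norm_of_nonneg (by linarith),
      div_mul_eq_mul_div, le_div_iff₀ (by positivity)] at hx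
    rw [le_div_iff₀ (by positivity)]
    nlinarith [le_abs_self C, sq_nonneg (Real.log x)]
  generalize Real.log x = l at *
  have hl0 : 0 < l := by linarith
  have hm0 : 0 < m := by linarith
  have h1 : -(0.5 * x / l ^ 2) ≤ θ x / l - θ x / m := by
    calc
      -(0.5 * x / l ^ 2) ≤ -(0.37 * x) / (l * m) := by
        rw [neg_div, neg_le_neg_iff, div_le_div_iff₀ (by positivity) (by positivity)]
        have : 0.37 * l ≤ 0.5 * m := by linarith
        nlinarith [mul_le_mul_of_nonneg_left this (by positivity : 0 ≤ x * l)]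
      _ ≤ θ x * (m - l) / (l * m) := by gcongr
      _ = _ := by field_simp
  have h2 : 0.54 * x / l ^ 2 = 0.5 * x / l ^ 2 + 0.04 * x / l ^ 2 := by ring
  linarith

theorem card_divisors_primorial (n : ℕ) : (primorial n).divisors.card = 2 ^ n.primeCounting := by
  rw [Nat.card_divisors (primorial_ne_zero n), primeFactors_primorial,
    ← Nat.primesLE_card_eq_primeCounting, ← Finset.prod_const]
  refine Finset.prod_congr rfl fun p hp ↦ ?_
  rw [← primeFactors_primorial] at hp
  rw [Nat.factorization_eq_one_of_squarefree (squarefree_primorial n)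
    (Nat.prime_of_mem_primeFactors hp) (Nat.dvd_of_mem_primeFactors hp)]

theorem div_log_le_div_log {u v : ℝ} (hu : Real.exp 1 ≤ u) (huv : u ≤ v) :
    u / Real.log u ≤ v / Real.log v := by
  have hu0 : 0 < u := (Real.exp_pos 1).trans_le hu
  have hlu : 1 ≤ Real.log u := (Real.le_log_iff_exp_le hu0).2 hu
  have hlv : Real.log u ≤ Real.log v := Real.log_le_log hu0 huv
  have h := Real.log_le_sub_one_of_pos (x := v / u) (div_pos (hu0.trans_le huv) hu0)
  rw [Real.log_div (by linarith) hu0.ne'] at h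
  have h' : (Real.log v - Real.log u + 1) * u ≤ v := (le_div_iff₀ hu0).1 (by linarith)
  rw [div_le_div_iff₀ (by linarith) (by linarith)]
  nlinarith

theorem div_log_sub_div_log_le {u v : ℝ} (hu : 1 < u) (huv : u ≤ v) :
    v / Real.log v - u / Real.log u ≤ (v - u) / Real.log u := by
  have hlu : 0 < Real.log u := Real.log_pos hu
  have : v / Real.log v ≤ v / Real.log u :=
    div_le_div_of_nonneg_left (by linarith) hlu (Real.log_le_log (by linarith) huv)
  rw [sub_div]
  linarith

theorem tendsto_div_log_atTop : Tendsto (fun u : ℝ ↦ u / Real.log u) atTop atTop := by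
  refine tendsto_atTop.2 fun C ↦ ?_
  have h := Real.isLittleO_log_id_atTop.bound (c := 1 / (|C| + 1)) (by positivity)
  filter_upwards [h, eventually_gt_atTop 1] with x hx hx1
  have hl : 0 < Real.log x := Real.log_pos hx1
  rw [Real.norm_of_nonneg hl.le, id, Real.norm_of_nonneg (by linarith),
    div_mul_eq_mul_div, le_div_iff₀ (by positivity)] at hx
  rw [le_div_iff₀ hl]
  nlinarith [le_abs_self C]

theorem exists_div_log_eq_add {L s : ℝ} (hL : 1 < L) (hs : 0 ≤ s) :
    ∃ v, L ≤ v ∧ v / Real.log v = L / Real.log L + s := by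
  obtain ⟨V, hV, hLV⟩ := ((tendsto_div_log_atTop.eventually_ge_atTop (L / Real.log L + s)).and
    (eventually_ge_atTop L)).exists
  have hc : ContinuousOn (fun u : ℝ ↦ u / Real.log u) (Set.Icc L V) := fun u hu ↦ by
    have h1 : 1 < u := hL.trans_le hu.1
    have : Real.log u ≠ 0 := (Real.log_pos h1).ne'
    have : u ≠ 0 := by linarith
    exact ContinuousAt.continuousWithinAt (by fun_prop (disch := assumption))
  obtain ⟨v, hv, hvs⟩ := intermediate_value_Icc hLV hc (show L / Real.log L + s ∈ _ from
    ⟨le_add_of_nonneg_right hs, hV⟩)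
  exact ⟨v, hv.1, hvs⟩

theorem exists_prime_log_mem_Icc {l : ℝ} (hl : 0 ≤ l) :
    ∃ q : ℕ, q.Prime ∧ l ≤ Real.log q ∧ Real.log q ≤ l + Real.log 2 := by
  have h1 : 1 ≤ Real.exp l := Real.one_le_exp hl
  obtain ⟨q, hq, hlt, hle⟩ := Nat.exists_prime_lt_and_le_two_mul ⌊Real.exp l⌋₊
    (Nat.floor_pos.2 h1).ne'
  have hq0 : (0 : ℝ) < q := by exact_mod_cast hq.pos
  refine ⟨q, hq, ?_, ?_⟩
  · rw [Real.le_log_iff_exp_le hq0]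
    exact (Nat.lt_of_floor_lt hlt).le
  · rw [Real.log_le_iff_le_exp hq0, Real.exp_add, Real.exp_log two_pos, mul_comm]
    have : (q : ℝ) ≤ 2 * (⌊Real.exp l⌋₊ : ℝ) := by exact_mod_cast hle
    linarith [Nat.floor_le (Real.exp_pos l).le]

theorem exists_card_divisors_eq_two_pow (B : ℝ) {ε : ℝ} (hε : 0 < ε) :
    ∃ n k : ℕ, 3 ≤ n ∧ n.divisors.card = 2 ^ k ∧
      B - ε ≤ k - Real.log n / Real.log (Real.log n) ∧
      k - Real.log n / Real.log (Real.log n) ≤ B := by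
  have hθ : Tendsto θ atTop atTop := tendsto_atTop_mono' _ eventually_mul_le_theta
    (tendsto_id.const_mul_atTop (by norm_num))
  obtain ⟨x, hD, hx, hL, hlog, hx3⟩ :=
    ((tendsto_primeCounting_sub_theta_div_log_theta.eventually_ge_atTop (B + 1)).and
    (eventually_mul_le_theta.and ((hθ.eventually_ge_atTop (Real.exp 1)).and
    (((Real.tendsto_log_atTop.comp hθ).eventually_ge_atTop (Real.log 2 / ε)).and
    (eventually_ge_atTop 3))))).exists
  set L := θ x
  have hL1 : 1 < L := (Real.one_lt_exp_iff.2 one_pos).trans_le hL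
  have hlL : 0 < Real.log L := Real.log_pos hL1
  obtain ⟨v, hLv, hv⟩ := exists_div_log_eq_add hL1
    (s := (Nat.primeCounting ⌊x⌋₊ : ℝ) - L / Real.log L + 1 - B) (by linarith)
  have hgap : 2 * Real.log L ≤ v - L := by
    have := div_log_sub_div_log_le hL1 hLv
    rw [← le_div_iff₀ hlL]
    linarith
  obtain ⟨q, hq, hql, hqu⟩ := exists_prime_log_mem_Icc (l := v - L) (by linarith)
  have hq0 : (0 : ℝ) < q := by exact_mod_cast hq.pos
  have hxq : x < q := by
    refine (Real.log_lt_log_iff (by linarith) hq0).1 (lt_of_lt_of_le ?_ (hgap.trans hql))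
    rw [← Real.log_rpow (by linarith)]
    refine Real.log_lt_log (by linarith) ?_
    norm_num
    nlinarith
  have hcop : (primorial ⌊x⌋₊).Coprime q := by
    rw [Nat.coprime_comm, hq.coprime_iff_not_dvd, hq.dvd_primorial_iff, not_le]
    exact (Nat.floor_lt (by linarith)).2 hxq
  have hlogn : Real.log ((primorial ⌊x⌋₊ * q : ℕ) : ℝ) = L + Real.log q := by
    rw [Nat.cast_mul, Real.log_mul (by exact_mod_cast primorial_ne_zero _) hq0.ne',
      ← theta_eq_log_primorial]
  refine ⟨primorial ⌊x⌋₊ * q, Nat.primeCounting ⌊x⌋₊ + 1, ?_, ?_, ?_, ?_⟩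
  · have : (3 : ℝ) < q := by linarith
    have : 3 < q := by exact_mod_cast this
    nlinarith [primorial_pos ⌊x⌋₊]
  · rw [hcop.card_divisors_mul, card_divisors_primorial, hq.divisors,
      Finset.card_pair hq.ne_one.symm, pow_succ]
  · rw [hlogn]
    have h1 := div_log_sub_div_log_le (hL1.trans_le hLv) (v := L + Real.log q) (by linarith)
    have h2 : (L + Real.log q - v) / Real.log v ≤ ε := by
      have hLv' : Real.log L ≤ Real.log v := Real.log_le_log (by linarith) hLv
      rw [div_le_iff₀ (by linarith)]
      have : Real.log 2 ≤ Real.log L * ε := (div_le_iff₀ hε).1 hlog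
      nlinarith
    push_cast
    linarith
  · rw [hlogn]
    have h1 := div_log_le_div_log (hL.trans hLv) (v := L + Real.log q) (by linarith)
    push_cast
    linarith

theorem theorem6p5 :
    Dense {y : ENNReal | ∃ n : ℕ, 3 ≤ n ∧
      y = ENNReal.ofReal
        ((n.divisors.card : ℝ) / (2 : ℝ) ^ (Real.log (n : ℝ) / Real.log (Real.log (n : ℝ))))} := by
  refine dense_of_exists_between fun a b hab ↦ ?_
  obtain ⟨t, hat, htb⟩ := ENNReal.lt_iff_exists_nnreal_btwn.1 hab
  obtain ⟨r, htr, hrb⟩ := ENNReal.lt_iff_exists_nnreal_btwn.1 htb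
  obtain ⟨w, hrw, hwb⟩ := ENNReal.lt_iff_exists_nnreal_btwn.1 hrb
  have htr' : (t : ℝ) < r := by exact_mod_cast htr
  have hrw' : (r : ℝ) < w := by exact_mod_cast hrw
  have hr0 : (0 : ℝ) < r := t.coe_nonneg.trans_lt htr'
  have hw0 : (0 : ℝ) < w := hr0.trans hrw'
  obtain ⟨n, k, hn, hcard, hl, hu⟩ := exists_card_divisors_eq_two_pow (Real.logb 2 w)
    (sub_pos.2 (Real.logb_lt_logb one_lt_two hr0 hrw'))
  refine ⟨_, ⟨n, hn, rfl⟩, ?_⟩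
  rw [hcard, Nat.cast_pow, Nat.cast_ofNat, ← Real.rpow_natCast, ← Real.rpow_sub two_pos]
  rw [sub_sub_cancel, Real.logb_le_iff_le_rpow one_lt_two hr0] at hl
  rw [Real.le_logb_iff_rpow_le one_lt_two hw0] at hu
  constructor
  · refine (hat.trans htr).trans_le ?_
    rw [← ENNReal.ofReal_coe_nnreal]
    exact ENNReal.ofReal_le_ofReal hl
  · refine lt_of_le_of_lt ?_ hwb
    rw [← ENNReal.ofReal_coe_nnreal]
    exact ENNReal.ofReal_le_ofReal hu
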